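/- Let $k$ be a field with $\mathrm{char}\,k\neq 2$, let $m,n\ge 1$ be integers, and let $D\in k^{n\times n}$ be a nonsingular diagonal matrix. For a square matrix $N$ over $k$ of size $d$ let $\mathfrak{o}(N)=\{X\in\mathfrak{gl}_d \mid X^tN+NX=0\}$, and let $M=0_m\oplus D=\begin{pmatrix}0_m&0\\0&D\end{pmatrix}$. Notation: $\mathfrak{rad}(\mathfrak{g})$ is the largest solvable ideal of a finite-dimensional Lie algebra $\mathfrak{g}$, $\mathfrak{g}^{\mathrm{ss}}=\mathfrak{g}/\mathfrak{rad}(\mathfrak{g})$, $\mathfrak{g}^{(0)}=\mathfrak{g}$ and $\mathfrak{g}^{(i+1)}=[\mathfrak{g}^{(i)},\mathfrak{g}^{(i)}]$; $\mathfrak{sl}_m\subseteq\mathfrak{gl}_m$ is the subalgebra of trace zero matrices and $\mathfrak{pgl}_m=\mathfrak{gl}_m/k\mathbb{I}_m$. For a Lie subalgebra $\mathfrak{g}\subseteq\mathfrak{gl}_r$, $\mathbb{V}_{\mathfrak{g}}$ is the restriction to $\mathfrak{g}$ of the vector representation $k^r$ (in particular $\mathbb{V}_{\mathfrak{o}(D)^{(i)}}=k^n$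 and $\mathbb{V}_{\mathfrak{sl}_m^{(i)}}=k^m$ as vector spaces). $k_1$ is the representation of $\mathfrak{gl}_1$ on $k$ in which $1\in\mathfrak{gl}_1$ acts as the identity. If $V$, $W$ are representations of $\mathfrak{g}$, $\mathfrak{h}$, then $\mathfrak{g}\oplus\mathfrak{h}$ acts on $\mathrm{Hom}(W,V)$ by $((x,y)\cdot\phi)(w)=x\cdot\phi(w)-\phi(y\cdot w)$. For a representation $V$ of $\mathfrak{g}$, $\mathfrak{g}\ltimes V$ is the semidirect product in which $V$ is an abelian ideal. The symbol $\cong$ denotes isomorphism of Lie algebras over $k$. Then: (a) If $n=1$ or $n\ge 3$, then $\mathfrak{rad}(\mathfrak{o}(M))\cong\mathfrak{gl}_1\ltimes k_1^{\oplus mn}$. If $n=2$, then $\mathfrak{rad}(\mathfrak{o}(M))\cong(\mathfrak{gl}_1\oplus\mathfrak{o}(D))\ltimes\mathrm{Hom}(\mathbb{V}_{\mathfrak{o}(D)},k_1^{\oplus m})$. (b) $\mathfrak{o}(M)^{\mathrm{ss}}\cong\mathfrak{gl}_m^{\mathrm{ss}}\oplus\mathfrak{o}(D)^{\mathrm{ss}}$.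 In particular, if $m\ge 2$ and $n\ge 3$, then $\mathfrak{o}(M)^{\mathrm{ss}}\cong\mathfrak{pgl}_m\oplus\mathfrak{o}(D)$ if $\mathrm{char}\,k\mid m$, and $\mathfrak{o}(M)^{\mathrm{ss}}\cong\mathfrak{sl}_m\oplus\mathfrak{o}(D)$ if $\mathrm{char}\,k\nmid m$. (c) If $m\ge 2$ or $n\ge 3$, then for every $i\ge 1$ $$\mathfrak{o}(M)^{(i)}\cong\left(\mathfrak{sl}_m^{(i-1)}\oplus\mathfrak{o}(D)^{(i)}\right)\ltimes\mathrm{Hom}\left(\mathbb{V}_{\mathfrak{o}(D)^{(i)}},\mathbb{V}_{\mathfrak{sl}_m^{(i-1)}}\right).$$ In particular, if $m\ge 2$ and $n\ge 3$, then $\mathfrak{o}(M)^{(1)}\cong(\mathfrak{sl}_m\oplus\mathfrak{o}(D))\ltimes\mathrm{Hom}(\mathbb{V}_{\mathfrak{o}(D)},\mathbb{V}_{\mathfrak{sl}_m})$ and $\mathfrak{o}(M)^{(2)}=\mathfrak{o}(M)^{(1)}$. (d) $\mathfrak{o}(M)$ is solvable if and only if $m\le 1$ and $n\le 2$. -/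

import Mathlib

attribute [local instance 100] LieRing.ofAssociativeRing

noncomputable section

namespace DegForm

/-! ### Lie algebras of matrices -/

/-- The Lie algebra `𝔬(M)` of all square matrices `X` with `Xᵀ * M + M * X = 0`. -/
abbrev orth {k : Type*} [Field k] {ι : Type*} [Fintype ι] [DecidableEq ι]
    (M : Matrix ι ι k) : LieSubalgebra k (Matrix ι ι k) :=
  skewAdjointMatricesLieSubalgebra M

theorem mem_orth {k : Type*} [Field k] {ι : Type*} [Fintype ι] [DecidableEq ι]
    (M X : Matrix ι ι k) : X ∈ orth M ↔ X.transpose * M + M * X = 0 := by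
  rw [mem_skewAdjointMatricesLieSubalgebra, mem_skewAdjointMatricesSubmodule]
  simp only [Matrix.IsSkewAdjoint, Matrix.IsAdjointPair, mul_neg]
  exact eq_neg_iff_add_eq_zero

/-- The block diagonal sum `0_m ⊕ D`. -/
abbrev zeroSum {k : Type*} [Field k] (m : ℕ) {n : ℕ} (D : Matrix (Fin n) (Fin n) k) :
    Matrix (Fin m ⊕ Fin n) (Fin m ⊕ Fin n) k :=
  Matrix.fromBlocks 0 0 0 D

/-- The Lie algebra `𝔤𝔩_m`. -/
abbrev gl (k : Type*) [Field k] (m : ℕ) : Type _ := Matrix (Fin m) (Fin m) k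

/-- The Lie algebra `𝔰𝔩_m` of trace zero matrices. -/
abbrev sl (k : Type*) [Field k] (m : ℕ) : LieSubalgebra k (gl k m) :=
  LieAlgebra.SpecialLinear.sl (Fin m) k

/-- The ideal of scalar matrices in `𝔤𝔩_m`. -/
def scalars (k : Type*) [Field k] (m : ℕ) : LieIdeal k (gl k m) :=
  { Submodule.span k {(1 : gl k m)} with
    lie_mem := by
      intro X Y hY
      obtain ⟨c, rfl⟩ := Submodule.mem_span_singleton.1 hY
      have h : ⁅X, c • (1 : gl k m)⁆ = 0 := by simp [Ring.lie_def]
      rw [h]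
      exact Submodule.zero_mem _ }

/-- The Lie algebra `𝔭𝔤𝔩_m`, the quotient of `𝔤𝔩_m` by the scalar matrices. -/
abbrev pgl (k : Type*) [Field k] (m : ℕ) : Type _ := gl k m ⧸ scalars k m

/-- The quotient `𝔤 / rad 𝔤`. -/
abbrev ssQuot (k : Type*) [Field k] (L : Type*) [LieRing L] [LieAlgebra k L] : Type _ :=
  L ⧸ LieAlgebra.radical k L

/-! ### Representations, as Lie algebra homomorphisms to endomorphisms -/

/-- The restriction to a subalgebra of `𝔤𝔩_ι` of the vector representation on column vectors. -/
def vecRep {k : Type*} [Field k] {ι : Type*} [Fintype ι] [DecidableEq ι]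
    (H : LieSubalgebra k (Matrix ι ι k)) : H →ₗ⁅k⁆ Module.End k (ι → k) :=
  (lieEquivMatrix' (R := k) (n := ι)).symm.toLieHom.comp H.incl

theorem vecRep_apply {k : Type*} [Field k] {ι : Type*} [Fintype ι] [DecidableEq ι]
    (H : LieSubalgebra k (Matrix ι ι k)) (X : H) (v : ι → k) :
    vecRep H X v = (X : Matrix ι ι k).mulVec v := rfl

/-- The representation `k_c^{⊕ ι}` of `𝔤𝔩_1`: the element `1` acts as multiplication by `c`. -/
def scalarRep (k : Type*) [Field k] (c : k) (ι : Type*) :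
    gl k 1 →ₗ⁅k⁆ Module.End k (ι → k) where
  toFun X := (c * X 0 0) • LinearMap.id
  map_add' X Y := by simp [mul_add, add_smul]
  map_smul' a X := by simp [smul_smul, mul_left_comm]
  map_lie' := by
    intro X Y
    ext v i
    simp [Ring.lie_def, Matrix.mul_apply, mul_comm, mul_left_comm]

/-- The representation of `𝔤 ⊕ 𝔥` on `Hom(W, V)` given by `(x, y) · φ = x ∘ φ - φ ∘ y`, where
`𝔤` acts on `V` through `ρ` and `𝔥` acts on `W` through `σ`. -/
def homRep {k : Type*} [Field k] {G H V W : Type*} [LieRing G] [LieAlgebra k G]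
    [LieRing H] [LieAlgebra k H] [AddCommGroup V] [Module k V] [AddCommGroup W] [Module k W]
    (σ : H →ₗ⁅k⁆ Module.End k W) (ρ : G →ₗ⁅k⁆ Module.End k V) :
    G × H →ₗ⁅k⁆ Module.End k (W →ₗ[k] V) where
  toFun z :=
    { toFun := fun φ => (ρ z.1).comp φ - φ.comp (σ z.2)
      map_add' := fun φ ψ => by ext w; simp; abel
      map_smul' := fun a φ => by ext w; simp [smul_sub] }
  map_add' z z' := by ext φ w; simp; abel
  map_smul' a z := by ext φ w; simp [smul_sub]
  map_lie' := by
    intro z z'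
    ext φ w
    simp [Ring.lie_def]
    abel

/-! ### The semidirect product of a Lie algebra and a representation -/

/-- A vector space, regarded as an abelian Lie algebra. -/
def AbelianLie (V : Type*) : Type _ := V

instance (V : Type*) [AddCommGroup V] : AddCommGroup (AbelianLie V) :=
  inferInstanceAs (AddCommGroup V)

instance (k V : Type*) [Field k] [AddCommGroup V] [Module k V] : Module k (AbelianLie V) :=
  inferInstanceAs (Module k V)

instance (V : Type*) [AddCommGroup V] : LieRing (AbelianLie V) where
  bracket _ _ := 0
  add_lie _ _ _ := (add_zero 0).symm
  lie_add _ _ _ := (add_zero 0).symm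
  lie_self _ := rfl
  leibniz_lie _ _ _ := (add_zero 0).symm

instance (k V : Type*) [Field k] [AddCommGroup V] [Module k V] : LieAlgebra k (AbelianLie V) where
  lie_smul _ _ _ := (smul_zero _).symm

/-- A representation, regarded as an action by derivations on the abelian Lie algebra `V`. -/
def derRep {k : Type*} [Field k] {L V : Type*} [LieRing L] [LieAlgebra k L]
    [AddCommGroup V] [Module k V] (ρ : L →ₗ⁅k⁆ Module.End k V) :
    L →ₗ⁅k⁆ LieDerivation k (AbelianLie V) (AbelianLie V) where
  toFun x :=
    { toLinearMap := (ρ x : V →ₗ[k] V)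
      leibniz' := fun _ _ => by
        change ρ x 0 = (0 : V) - 0
        rw [map_zero, sub_zero] }
  map_add' x y := by
    apply LieDerivation.ext
    intro v
    exact LinearMap.congr_fun (map_add ρ x y) v
  map_smul' a x := by
    apply LieDerivation.ext
    intro v
    exact LinearMap.congr_fun (map_smul ρ a x) v
  map_lie' := by
    intro x y
    apply LieDerivation.ext
    intro v
    rw [LieDerivation.commutator_apply]
    exact LinearMap.congr_fun (LieHom.map_lie ρ x y) v

/-- The semidirect product `𝔤 ⋉ V` of a Lie algebra and the representation `ρ` of it on `V`. -/
abbrev Semidirect {k : Type*} [Field k] {L V : Type*} [LieRing L] [LieAlgebra k L]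
    [AddCommGroup V] [Module k V] (ρ : L →ₗ⁅k⁆ Module.End k V) : Type _ :=
  LieAlgebra.SemiDirectSum (AbelianLie V) L (derRep ρ)

theorem semidirect_lie {k : Type*} [Field k] {L V : Type*} [LieRing L] [LieAlgebra k L]
    [AddCommGroup V] [Module k V] (ρ : L →ₗ⁅k⁆ Module.End k V) (v w : V) (x y : L) :
    (⁅(⟨v, x⟩ : Semidirect ρ), (⟨w, y⟩ : Semidirect ρ)⁆ : Semidirect ρ) =
      ⟨(ρ x w - ρ y v : V), ⁅x, y⁆⟩ := by
  rw [LieAlgebra.SemiDirectSum.lie_eq_mk]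
  congr 1
  change (0 : V) + ρ x w - ρ y v = _
  rw [zero_add]

end DegForm

end

/-!
A matrix in block form satisfies the equation of `𝔬(0_m ⊕ D)` if and only if its lower left block
vanishes and its lower right block lies in `𝔬(D)` (`exists_eq_fromBlocks`, `fromBlocks_mem_orth`).
So `𝔬(0_m ⊕ D)` is the semidirect product of `𝔤𝔩_m ⊕ 𝔬(D)` and its abelian ideal of upper right
corners, and every ideal that is a preimage under the projection `blockHom` to the diagonal blocks
is a semidirect product as well (`nonempty_ideal_equiv_semidirect`). It remains to identify the
radical and the derived algebras as such preimages.

The radical is the preimage of `rad 𝔤𝔩_m ⊕ rad 𝔬(D)` because the kernel of `blockHom` is abelian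
(`mem_radical_orth_zeroSum`). Since `2` is invertible, `rad 𝔤𝔩_m` consists of the scalar matrices:
an ideal with a nonscalar member contains an off-diagonal matrix unit, hence an `𝔰𝔩₂`-triple, hence
is not solvable (`radical_gl`). For `n ≤ 2` the algebra `𝔬(D)` is abelian. For `n ≥ 3` it has
trivial radical (`hasTrivialRadical_orth`). Indeed, let `X` be a member of an abelian ideal with
`X_ij ≠ 0`, and let `l` be a third index. A multiple of `ad(rot i j)²` is a projection that deletes
entries of matrices (`exists_mem_ideal_mask`); two such projections turn `X` into a member `Z` of
the ideal with entries only at `(i, j)`, at `(l, b)` with `b` outside `{i, j, l}`, and at the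
transposed positions. As `ad(Z)² = 0`, the entries at `(l, b)` vanish
(`mul_mul_eq_of_lie_lie_rot_eq_zero`), so `rot i j` is in the ideal; but `ad(rot i j)² ≠ 0`.

For the derived series, `𝔰𝔩_m` is perfect for all `m`, and `𝔬(D)` is perfect for `n ≥ 3`. If `m ≥ 2`
or `n ≥ 3`, one of them acts on the corner without coinvariants, so the corner lies in every derived
algebra (`corner_mem_derivedSeries`), and the derived algebras are preimages under `blockHom`
(`mem_derivedSeries_orth_zeroSum`).
-/

noncomputable section

namespace DegForm

/-! ### Solvable ideals and radicals -/

section General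

open LieAlgebra

variable {k L L' : Type*} [Field k] [LieRing L] [LieAlgebra k L] [LieRing L'] [LieAlgebra k L']

theorem isSolvable_ideal_iff (I : LieIdeal k L) :
    IsSolvable I ↔ ∃ n, derivedSeriesOfIdeal k L n I = ⊥ := by
  simp only [isSolvable_iff k, LieIdeal.derivedSeries_eq_bot_iff]

theorem map_derivedSeriesOfIdeal_le (f : L →ₗ⁅k⁆ L') (I : LieIdeal k L) (n : ℕ) :
    (derivedSeriesOfIdeal k L n I).map f ≤ derivedSeriesOfIdeal k L' n (I.map f) := by
  induction n with
  | zero => rfl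
  | succ n ih =>
    simp only [derivedSeriesOfIdeal_succ]
    exact (LieIdeal.map_bracket_le f).trans (LieSubmodule.mono_lie ih ih)

theorem map_derivedSeriesOfIdeal_eq {f : L →ₗ⁅k⁆ L'} (hf : Function.Surjective f)
    (I : LieIdeal k L) (n : ℕ) :
    (derivedSeriesOfIdeal k L n I).map f = derivedSeriesOfIdeal k L' n (I.map f) := by
  induction n with
  | zero => rfl
  | succ n ih => simp only [derivedSeriesOfIdeal_succ, LieIdeal.map_bracket_eq f hf, ih]

theorem map_mem_derivedSeries (f : L →ₗ⁅k⁆ L') {x : L} {n : ℕ} (hx : x ∈ derivedSeries k L n) :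
    f x ∈ derivedSeries k L' n :=
  LieIdeal.derivedSeries_map_le n (LieIdeal.mem_map hx)

theorem map_mem_radical [IsNoetherian k L] {f : L →ₗ⁅k⁆ L'} (hf : Function.Surjective f) {x : L}
    (hx : x ∈ radical k L) : f x ∈ radical k L' := by
  obtain ⟨n, hn⟩ := (isSolvable_ideal_iff (radical k L)).1 inferInstance
  have h : IsSolvable ((radical k L).map f) := by
    refine (isSolvable_ideal_iff _).2 ⟨n, ?_⟩
    rw [← map_derivedSeriesOfIdeal_eq hf, hn, LieIdeal.map_eq_bot_iff]
    exact bot_le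
  exact (le_sSup h : _ ≤ radical k L') (LieIdeal.mem_map hx)

/-- Solvability is stable under extensions, so the radical is the preimage of the radical under
a surjection with solvable kernel. -/
theorem radical_eq_comap [IsNoetherian k L] [IsNoetherian k L'] {f : L →ₗ⁅k⁆ L'}
    (hf : Function.Surjective f) (hker : IsSolvable f.ker) :
    radical k L = (radical k L').comap f := by
  refine le_antisymm (fun x hx => LieIdeal.mem_comap.2 (map_mem_radical hf hx)) ?_
  obtain ⟨a, ha⟩ := (isSolvable_ideal_iff (radical k L')).1 inferInstance
  obtain ⟨b, hb⟩ := (isSolvable_ideal_iff f.ker).1 hker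
  refine le_sSup ((isSolvable_ideal_iff _).2 ⟨b + a, ?_⟩)
  rw [derivedSeriesOfIdeal_add, eq_bot_iff, ← hb]
  refine derivedSeriesOfIdeal_mono ?_ b
  rw [← LieIdeal.map_eq_bot_iff, eq_bot_iff, ← ha]
  exact (map_derivedSeriesOfIdeal_le f _ a).trans
    (derivedSeriesOfIdeal_mono LieIdeal.map_comap_le a)

theorem mem_radical_prod [IsNoetherian k L] [IsNoetherian k L'] (x : L × L') :
    x ∈ radical k (L × L') ↔ x.1 ∈ radical k L ∧ x.2 ∈ radical k L' := by
  refine ⟨fun h => ⟨map_mem_radical (f := LieHom.fst k L L') LieHom.fst_surjective h,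
    map_mem_radical (f := LieHom.snd k L L') LieHom.snd_surjective h⟩, fun h => ?_⟩
  let J : LieIdeal k (L × L') :=
    (radical k L).comap (LieHom.fst k L L') ⊓ (radical k L').comap (LieHom.snd k L L')
  have hJ : IsSolvable J := by
    obtain ⟨a, ha⟩ := (isSolvable_ideal_iff (radical k L)).1 inferInstance
    obtain ⟨b, hb⟩ := (isSolvable_ideal_iff (radical k L')).1 inferInstance
    refine (isSolvable_ideal_iff _).2 ⟨a + b, ?_⟩
    rw [eq_bot_iff]
    intro y hy
    have h1 : (derivedSeriesOfIdeal k (L × L') (a + b) J).map (LieHom.fst k L L') ≤ ⊥ := by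
      rw [← ha]
      exact (map_derivedSeriesOfIdeal_le _ _ _).trans (derivedSeriesOfIdeal_le
        ((LieIdeal.map_mono inf_le_left).trans LieIdeal.map_comap_le) (Nat.le_add_right a b))
    have h2 : (derivedSeriesOfIdeal k (L × L') (a + b) J).map (LieHom.snd k L L') ≤ ⊥ := by
      rw [← hb]
      exact (map_derivedSeriesOfIdeal_le _ _ _).trans (derivedSeriesOfIdeal_le
        ((LieIdeal.map_mono inf_le_right).trans LieIdeal.map_comap_le) (Nat.le_add_left b a))
    exact Prod.ext (h1 (LieIdeal.mem_map hy)) (h2 (LieIdeal.mem_map hy))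
  exact (le_sSup hJ : J ≤ radical k (L × L')) ⟨h.1, h.2⟩

/-- An `𝔰𝔩₂`-triple with one, hence each, of its members in an ideal survives in the whole derived
series of the ideal. -/
theorem not_isSolvable_of_isSl2Triple (h2 : (2 : k) ≠ 0) {h e f : L} (t : IsSl2Triple h e f)
    {I : LieIdeal k L} (he : e ∈ I) : ¬ IsSolvable I := by
  intro hI
  obtain ⟨n, hn⟩ := (isSolvable_ideal_iff I).1 hI
  have key : ∀ (J : LieIdeal k L) (x : L), (2 : k) • x ∈ J → x ∈ J := fun J x hJ => by
    have := J.smul_mem (2 : k)⁻¹ hJ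
    rwa [smul_smul, inv_mul_cancel₀ h2, one_smul] at this
  have h2e : ⁅h, e⁆ = (2 : k) • e := by rw [t.lie_h_e_nsmul, two_nsmul, two_smul]
  have h2f : -⁅h, f⁆ = (2 : k) • f := by rw [t.lie_h_f_nsmul, neg_neg, two_nsmul, two_smul]
  have main : ∀ m, h ∈ derivedSeriesOfIdeal k L m I ∧ e ∈ derivedSeriesOfIdeal k L m I ∧
      f ∈ derivedSeriesOfIdeal k L m I := by
    intro m
    induction m with
    | zero =>
      have hh : h ∈ I := by
        rw [← t.lie_e_f]
        exact lie_mem_left k L I e f he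
      exact ⟨hh, he, key I f (h2f ▸ neg_mem (lie_mem_left k L I h f hh))⟩
    | succ m ih =>
      rw [derivedSeriesOfIdeal_succ]
      obtain ⟨ih1, ih2, ih3⟩ := ih
      exact ⟨t.lie_e_f ▸ LieSubmodule.lie_mem_lie ih2 ih3,
        key _ e (h2e ▸ LieSubmodule.lie_mem_lie ih1 ih2),
        key _ f (h2f ▸ neg_mem (LieSubmodule.lie_mem_lie ih1 ih3))⟩
  have := (main n).1
  rw [hn] at this
  exact t.h_ne_zero this

theorem derivedSeries_eq_top_of_span {s : Set L} (hs : Submodule.span k s = ⊤)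
    (h : ∀ x ∈ s, ∃ y z : L, ∃ c : k, x = c • ⁅y, z⁆) (n : ℕ) : derivedSeries k L n = ⊤ := by
  refine LieIdeal.derivedSeries_eq_top n ?_
  rw [eq_top_iff, ← LieSubmodule.toSubmodule_le_toSubmodule, LieSubmodule.top_toSubmodule, ← hs,
    Submodule.span_le]
  intro x hx
  obtain ⟨y, z, c, rfl⟩ := h x hx
  exact (derivedSeries k L 1).smul_mem c
    (LieSubmodule.lie_mem_lie (LieSubmodule.mem_top y) (LieSubmodule.mem_top z))

theorem nonempty_equiv_of_range_eq {L'' : Type*} [LieRing L''] [LieAlgebra k L'']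
    (f : L →ₗ⁅k⁆ L'') (g : L' →ₗ⁅k⁆ L'') (hf : Function.Injective f) (hg : Function.Injective g)
    (h : f.range = g.range) : Nonempty (L ≃ₗ⁅k⁆ L') :=
  ⟨(f.equivRangeOfInjective hf).trans
    ((LieEquiv.ofEq _ _ (by rw [h])).trans (g.equivRangeOfInjective hg).symm)⟩

theorem nonempty_quotient_equiv (f : L →ₗ⁅k⁆ L') (hf : Function.Surjective f) (I : LieIdeal k L)
    (hI : ∀ x, x ∈ I ↔ f x = 0) : Nonempty ((L ⧸ I) ≃ₗ⁅k⁆ L') := by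
  have h : I = f.ker := by
    ext x
    rw [hI, LieHom.mem_ker]
  subst h
  exact ⟨f.quotKerEquivRange.trans ((LieEquiv.ofEq _ _
    (by rw [f.range_eq_top.2 hf])).trans LieSubalgebra.topEquiv)⟩

end General

/-! ### The radical of `𝔤𝔩_m` and the derived series of `𝔰𝔩_m` -/

section GeneralLinear

open LieAlgebra Matrix

variable {k : Type*} [Field k] {m : ℕ}

theorem mem_scalars {X : gl k m} : X ∈ scalars k m ↔ ∃ c : k, c • (1 : gl k m) = X :=
  Submodule.mem_span_singleton

theorem isSl2Triple_single {i j : Fin m} (h : i ≠ j) :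
    IsSl2Triple (single i i 1 - single j j 1 : gl k m) (single i j 1) (single j i 1) where
  h_ne_zero := fun h0 => by
    have := congrFun (congrFun h0 i) i
    simp [h.symm] at this
  lie_e_f := by simp [Ring.lie_def]
  lie_h_e_nsmul := by
    simp [Ring.lie_def, sub_mul, mul_sub, single_mul_single_of_ne, h.symm, ← single_add,
      one_add_one_eq_two]
  lie_h_f_nsmul := by
    simp [Ring.lie_def, sub_mul, mul_sub, single_mul_single_of_ne, h, ← one_add_one_eq_two,
      single_add]
    abel

theorem single_notMem_radical (h2 : (2 : k) ≠ 0) {i j : Fin m} (h : i ≠ j) {c : k} (hc : c ≠ 0) :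
    (single i j c : gl k m) ∉ radical k (gl k m) := by
  intro hmem
  have h1 := (radical k (gl k m)).smul_mem c⁻¹ hmem
  rw [smul_single, smul_eq_mul, inv_mul_cancel₀ hc] at h1
  exact not_isSolvable_of_isSl2Triple h2 (isSl2Triple_single h) h1 inferInstance

/-- A matrix in the radical is scalar: otherwise some `ad(E_ji)²` or `ad(E_ij)` would send it to a
nonzero multiple of an off-diagonal matrix unit. -/
theorem radical_gl (h2 : (2 : k) ≠ 0) : radical k (gl k m) = scalars k m := by
  refine le_antisymm (fun X hX => ?_) ?_
  · have hoff : ∀ i j, i ≠ j → X i j = 0 := by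
      intro i j hij
      by_contra hne
      refine single_notMem_radical h2 hij.symm (c := -(2 * X i j)) (by simp [h2, hne]) ?_
      have h1 := lie_mem_right k (gl k m) _ (single j i 1) _
        (lie_mem_right k (gl k m) _ (single j i 1) X hX)
      convert h1 using 1
      have hsq : (single j i 1 : gl k m) * single j i 1 = 0 :=
        single_mul_single_of_ne _ _ _ _ hij _
      have hs : (single j i 1 : gl k m) * X * single j i 1 = single j i (X i j) := by
        rw [single_mul_mul_single]; simp
      have : ⁅(single j i 1 : gl k m), ⁅(single j i 1 : gl k m), X⁆⁆ =
          single j i 1 * single j i 1 * X - (2 : ℕ) • (single j i 1 * X * single j i 1)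
            + X * (single j i 1 * single j i 1) := by
        simp only [Ring.lie_def]
        noncomm_ring
      rw [this, hsq, hs]
      ext a b
      simp only [single_apply]
      split_ifs <;> simp [two_mul, *]
    have hdiag : ∀ i j, X i i = X j j := by
      intro i j
      by_contra hne
      have hij : i ≠ j := fun h => hne (h ▸ rfl)
      refine single_notMem_radical h2 hij (c := X i i - X j j) (sub_ne_zero.2 hne) ?_
      have h1 := lie_mem_left k (gl k m) _ X (single i j 1) hX
      convert h1 using 1
      have hX : X = diagonal fun a => X a a := by
        ext a b
        by_cases hab : a = b
        · simp [hab]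
        · simp [hab, hoff a b hab]
      rw [hX, Ring.lie_def]
      ext a b
      simp only [Matrix.sub_apply, diagonal_mul, mul_diagonal, single_apply, diagonal_apply_eq]
      split_ifs with h
      · rw [h.1, h.2]; ring
      · ring
    refine mem_scalars.2 ?_
    rcases isEmpty_or_nonempty (Fin m) with hm | ⟨⟨a⟩⟩
    · exact ⟨0, Subsingleton.elim _ _⟩
    · refine ⟨X a a, ?_⟩
      ext i j
      by_cases hij : i = j
      · subst hij; simp [hdiag i a]
      · simp [hij, hoff i j hij]
  · refine le_trans (fun X hX => ?_) (center_le_radical k (gl k m))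
    obtain ⟨c, rfl⟩ := mem_scalars.1 hX
    intro Y
    simp [Ring.lie_def]

theorem mem_submodule_of_trace_eq_zero (P : Submodule k (gl k m))
    (h1 : ∀ i j, i ≠ j → single i j 1 ∈ P)
    (h2 : ∀ i j, i ≠ j → single i i 1 - single j j 1 ∈ P) {X : gl k m} (hX : X.trace = 0) :
    X ∈ P := by
  rcases isEmpty_or_nonempty (Fin m) with hm | ⟨⟨a⟩⟩
  · rw [Subsingleton.elim X 0]; exact P.zero_mem
  have key : X = ∑ i, ∑ j, X i j • (single i j 1 - if i = j then single a a 1 else 0) := by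
    have htr : ∑ i, ∑ j, X i j • (if i = j then single a a 1 else 0 : gl k m) = 0 := by
      simp only [smul_ite, smul_zero, Finset.sum_ite_eq, Finset.mem_univ, if_true]
      rw [← Finset.sum_smul]
      have : ∑ i, X i i = 0 := hX
      rw [this, zero_smul]
    simp only [smul_sub, Finset.sum_sub_distrib, htr, sub_zero]
    simpa using matrix_eq_sum_single X
  rw [key]
  refine P.sum_mem fun i _ => P.sum_mem fun j _ => P.smul_mem _ ?_
  by_cases hij : i = j
  · subst hij
    rw [if_pos rfl]
    by_cases hia : i = a
    · rw [hia, sub_self]; exact P.zero_mem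
    · exact h2 i a hia
  · rw [if_neg hij, sub_zero]; exact h1 i j hij

theorem mem_sl {X : gl k m} : X ∈ sl k m ↔ X.trace = 0 :=
  LinearMap.mem_ker

/-- In characteristic different from two, `𝔰𝔩_m` is perfect for all `m`: each off-diagonal matrix
unit is a multiple of its bracket with the corresponding coroot. -/
theorem derivedSeries_sl (h2 : (2 : k) ≠ 0) (n : ℕ) : derivedSeries k (sl k m) n = ⊤ := by
  have hE : ∀ i j : Fin m, i ≠ j → (single i j 1 : gl k m) ∈ sl k m := fun i j h => by
    rw [mem_sl]; exact trace_single_eq_of_ne _ _ _ h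
  have hH : ∀ i j : Fin m, i ≠ j → (single i i 1 - single j j 1 : gl k m) ∈ sl k m :=
    fun i j h => by simp [mem_sl]
  refine derivedSeries_eq_top_of_span (s := {x : sl k m | ∃ i j : Fin m, i ≠ j ∧
    ((x : gl k m) = single i j 1 ∨ (x : gl k m) = single i i 1 - single j j 1)}) ?_ ?_ n
  · rw [eq_top_iff]
    rintro ⟨X, hX⟩ -
    have := mem_submodule_of_trace_eq_zero ((Submodule.span k {x : sl k m | ∃ i j : Fin m, i ≠ j ∧
      ((x : gl k m) = single i j 1 ∨ (x : gl k m) = single i i 1 - single j j 1)}).map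
      (sl k m).toSubmodule.subtype)
      (fun i j h => ⟨⟨_, hE i j h⟩, Submodule.subset_span ⟨i, j, h, Or.inl rfl⟩, rfl⟩)
      (fun i j h => ⟨⟨_, hH i j h⟩, Submodule.subset_span ⟨i, j, h, Or.inr rfl⟩, rfl⟩) hX
    obtain ⟨y, hy, hyX⟩ := this
    have : y = ⟨X, hX⟩ := Subtype.ext hyX
    rwa [← this]
  · rintro x ⟨i, j, h, hx | hx⟩
    · refine ⟨⟨_, hH i j h⟩, ⟨_, hE i j h⟩, (2 : k)⁻¹, Subtype.ext ?_⟩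
      have := (isSl2Triple_single (k := k) h).lie_h_e_nsmul
      simp only [SetLike.val_smul, LieSubalgebra.coe_bracket, hx]
      rw [this, two_nsmul, ← two_smul k, smul_smul, inv_mul_cancel₀ h2, one_smul]
    · refine ⟨⟨_, hE i j h⟩, ⟨_, hE j i h.symm⟩, 1, Subtype.ext ?_⟩
      have := (isSl2Triple_single (k := k) h).lie_e_f
      simp only [one_smul, LieSubalgebra.coe_bracket, hx]
      exact this.symm

theorem trace_eq_zero_of_mem_derivedSeries {X : gl k m} {n : ℕ} (hn : 1 ≤ n)
    (hX : X ∈ derivedSeries k (gl k m) n) : X.trace = 0 := by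
  have h1 : X ∈ (derivedSeries k (gl k m) 1).toSubmodule := derivedSeriesOfIdeal_antitone _ hn hX
  have h2 : (derivedSeries k (gl k m) 1).toSubmodule ≤
      LinearMap.ker (traceLinearMap (Fin m) k k) := by
    change (derivedSeriesOfIdeal k (gl k m) (0 + 1) ⊤).toSubmodule ≤ _
    rw [derivedSeriesOfIdeal_succ, derivedSeriesOfIdeal_zero,
      LieSubmodule.lieIdeal_oper_eq_linear_span', Submodule.span_le]
    rintro _ ⟨A, -, B, -, rfl⟩
    exact matrix_trace_commutator_zero _ _ A B
  exact h2 h1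

end GeneralLinear

/-! ### The orthogonal Lie algebra of a nonsingular diagonal matrix -/

section Orthogonal

open LieAlgebra Matrix

variable {k : Type*} [Field k] {n : ℕ} {d : Fin n → k}

theorem mem_orth_diagonal {X : Matrix (Fin n) (Fin n) k} :
    X ∈ orth (diagonal d) ↔ ∀ p q, X q p * d q + d p * X p q = 0 := by
  rw [mem_orth, ← Matrix.ext_iff]
  simp [mul_diagonal, diagonal_mul]

/-- The infinitesimal rotation `d_j E_ij - d_i E_ji` in the `(i, j)`-plane. -/
def rot (d : Fin n → k) (i j : Fin n) : orth (diagonal d) :=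
  ⟨single i j (d j) - single j i (d i), mem_orth_diagonal.2 fun p q => by
    simp only [Matrix.sub_apply, single_apply]
    grind⟩

theorem rot_apply (i j p q : Fin n) : (rot d i j : Matrix (Fin n) (Fin n) k) p q =
    (if i = p ∧ j = q then d j else 0) - (if j = p ∧ i = q then d i else 0) := rfl

theorem rot_mul_apply (X : Matrix (Fin n) (Fin n) k) (i j p q : Fin n) :
    ((rot d i j : Matrix (Fin n) (Fin n) k) * X) p q =
      (if p = i then d j * X j q else 0) - (if p = j then d i * X i q else 0) := by
  simp only [rot, sub_mul, Matrix.sub_apply]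
  congr 1 <;> split_ifs with h <;> [subst h; skip; subst h; skip] <;> simp [*]

theorem mul_rot_apply (X : Matrix (Fin n) (Fin n) k) (i j p q : Fin n) :
    (X * (rot d i j : Matrix (Fin n) (Fin n) k)) p q =
      (if q = j then X p i * d j else 0) - (if q = i then X p j * d i else 0) := by
  simp only [rot, mul_sub, Matrix.sub_apply]
  congr 1 <;> split_ifs with h <;> [subst h; skip; subst h; skip] <;> simp [*]

theorem rot_lie_rot {i j l : Fin n} (hij : i ≠ j) (hjl : j ≠ l) (hil : i ≠ l) :
    ⁅rot d i j, rot d j l⁆ = d j • rot d i l := by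
  ext p q
  simp only [LieSubalgebra.coe_bracket, SetLike.val_smul, Ring.lie_def, Matrix.sub_apply,
    mul_rot_apply, Matrix.smul_apply, rot_apply, smul_eq_mul]
  grind

theorem rot_swap (i j : Fin n) : rot d j i = - rot d i j := by
  ext p q
  simp [rot]

theorem rot_ne_zero (hd : ∀ i, d i ≠ 0) {i j : Fin n} (hij : i ≠ j) : rot d i j ≠ 0 := by
  intro h
  have := congrArg (fun X : orth (diagonal d) => (X : Matrix (Fin n) (Fin n) k) i j) h
  simp [rot_apply, hij, hij.symm, hd j] at this

theorem exists_ne_ne (hn : 3 ≤ n) (i j : Fin n) : ∃ l, l ≠ i ∧ l ≠ j := by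
  have h : ({i, j} : Finset (Fin n)).card < (Finset.univ : Finset (Fin n)).card :=
    lt_of_le_of_lt Finset.card_le_two (by simpa [Nat.lt_iff_add_one_le] using hn)
  obtain ⟨l, -, hl⟩ := Finset.exists_mem_notMem_of_card_lt_card h
  exact ⟨l, by simpa using hl⟩

theorem orth_apply_self (h2 : (2 : k) ≠ 0) (hd : ∀ i, d i ≠ 0) (X : orth (diagonal d))
    (i : Fin n) : (X : Matrix (Fin n) (Fin n) k) i i = 0 := by
  have h := mem_orth_diagonal.1 X.2 i i
  have h' : 2 * d i * (X : Matrix (Fin n) (Fin n) k) i i = 0 := by linear_combination h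
  simpa [h2, hd i] using h'

theorem span_rot (h2 : (2 : k) ≠ 0) (hd : ∀ i, d i ≠ 0) :
    Submodule.span k {x | ∃ i j, i ≠ j ∧ x = rot d i j} = ⊤ := by
  rw [eq_top_iff]
  rintro X -
  have key : X = (2 : k)⁻¹ • ∑ i, ∑ j,
      ((X : Matrix (Fin n) (Fin n) k) i j * (d j)⁻¹) • rot d i j := by
    rw [eq_inv_smul_iff₀ h2]
    apply Subtype.ext
    ext p q
    have hX := mem_orth_diagonal.1 X.2 p q
    have hs : ((∑ i, ∑ j, ((X : Matrix (Fin n) (Fin n) k) i j * (d j)⁻¹) • rot d i j :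
        orth (diagonal d)) : Matrix (Fin n) (Fin n) k) = ∑ i, ∑ j,
        ((X : Matrix (Fin n) (Fin n) k) i j * (d j)⁻¹) •
          (rot d i j : Matrix (Fin n) (Fin n) k) := by
      simp
    rw [hs]
    simp only [Matrix.sum_apply, Matrix.smul_apply, rot_apply, smul_eq_mul, mul_sub,
      Finset.sum_sub_distrib, SetLike.val_smul]
    simp only [mul_ite, mul_zero, ite_and, Finset.sum_ite_eq', Finset.mem_univ,
      if_true, Finset.sum_ite_irrel, Finset.sum_const_zero]
    have := hd p
    have := hd q
    field_simp
    linear_combination hX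
  rw [key]
  refine Submodule.smul_mem _ _ (Submodule.sum_mem _ fun i _ => Submodule.sum_mem _ fun j _ => ?_)
  by_cases hij : i = j
  · rw [hij, orth_apply_self h2 hd, zero_mul, zero_smul]
    exact Submodule.zero_mem _
  · exact Submodule.smul_mem _ _ (Submodule.subset_span ⟨i, j, hij, rfl⟩)

theorem derivedSeries_orth (h2 : (2 : k) ≠ 0) (hd : ∀ i, d i ≠ 0) (hn : 3 ≤ n) (r : ℕ) :
    derivedSeries k (orth (diagonal d)) r = ⊤ := by
  refine derivedSeries_eq_top_of_span (span_rot h2 hd) ?_ r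
  rintro _ ⟨i, j, hij, rfl⟩
  obtain ⟨l, hli, hlj⟩ := exists_ne_ne hn i j
  refine ⟨rot d i l, rot d l j, (d l)⁻¹, ?_⟩
  rw [rot_lie_rot hli.symm hlj hij, smul_smul, inv_mul_cancel₀ (hd l), one_smul]

/-- The endomorphism `-(d_i d_j)⁻¹ ad(rot i j)²` is a projection which keeps exactly the entries
with one index in `{i, j}` and the other outside; in particular it preserves every ideal. -/
theorem exists_mem_ideal_mask (h2 : (2 : k) ≠ 0) (hd : ∀ i, d i ≠ 0)
    {I : LieIdeal k (orth (diagonal d))} {X : orth (diagonal d)} (hX : X ∈ I)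
    {i j : Fin n} (hij : i ≠ j) :
    ∃ Y ∈ I, ∀ p q, (Y : Matrix (Fin n) (Fin n) k) p q =
      if (p = i ∨ p = j) ↔ (q = i ∨ q = j) then 0 else (X : Matrix (Fin n) (Fin n) k) p q := by
  refine ⟨(-(d i * d j)⁻¹) • ⁅rot d i j, ⁅rot d i j, X⁆⁆,
    I.smul_mem _ (lie_mem_right k _ I _ _ (lie_mem_right k _ I _ _ hX)), fun p q => ?_⟩
  have hr := mem_orth_diagonal.1 X.2
  have hi := orth_apply_self h2 hd X i
  have hj := orth_apply_self h2 hd X j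
  simp only [LieSubalgebra.coe_bracket, SetLike.val_smul, Ring.lie_def, Matrix.sub_apply,
    rot_mul_apply, mul_rot_apply, Matrix.smul_apply, smul_eq_mul]
  generalize (X : Matrix (Fin n) (Fin n) k) = A at *
  rw [neg_mul, ← mul_neg, inv_mul_eq_iff_eq_mul₀ (mul_ne_zero (hd i) (hd j))]
  have hji := hij.symm
  have h1 := hr i j
  clear hr
  by_cases hpi : p = i <;> by_cases hpj : p = j <;> by_cases hqi : q = i <;> by_cases hqj : q = j
  all_goals try subst p
  all_goals try subst q
  all_goals first | contradiction | simp [*]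
  all_goals grind

/-- If `ad(Z)²` kills `rot a b`, the corresponding entries of `Z (rot a b) Z` vanish. -/
theorem mul_mul_eq_of_lie_lie_rot_eq_zero (h2 : (2 : k) ≠ 0) {Z : orth (diagonal d)} {a b : Fin n}
    (h : ⁅Z, ⁅Z, rot d a b⁆⁆ = 0) {p q : Fin n} (hpa : p ≠ a) (hpb : p ≠ b) (hqa : q ≠ a)
    (hqb : q ≠ b) : (Z : Matrix (Fin n) (Fin n) k) p a * d b * (Z : Matrix (Fin n) (Fin n) k) b q =
      (Z : Matrix (Fin n) (Fin n) k) p b * d a * (Z : Matrix (Fin n) (Fin n) k) a q := by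
  have h0 := congrArg (fun X : orth (diagonal d) => (X : Matrix (Fin n) (Fin n) k)) h
  simp only [LieSubalgebra.coe_bracket, Ring.lie_def] at h0
  set A := (Z : Matrix (Fin n) (Fin n) k)
  set F := (rot d a b : Matrix (Fin n) (Fin n) k) with hF
  have h1 : A * A * F + F * (A * A) = (2 : k) • (A * (F * A)) := by
    rw [two_smul, ← sub_eq_zero]
    have : A * A * F + F * (A * A) - (A * (F * A) + A * (F * A)) =
      A * (A * F - F * A) - (A * F - F * A) * A := by noncomm_ring
    rw [this]
    exact h0
  have h3 := congrFun (congrFun h1 p) q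
  rw [Matrix.add_apply, Matrix.smul_apply, hF, mul_rot_apply, rot_mul_apply, if_neg hqa, if_neg hqb,
    if_neg hpa, if_neg hpb, Matrix.mul_apply] at h3
  simp only [rot_mul_apply, sub_zero, add_zero, smul_eq_mul, mul_sub, mul_ite, mul_zero,
    Finset.sum_sub_distrib, Finset.sum_ite_eq', Finset.mem_univ, if_true] at h3
  have h4 : A p a * (d b * A b q) - A p b * (d a * A a q) = 0 := by
    refine (mul_eq_zero.1 (?_ : (2 : k) * _ = 0)).resolve_left h2
    linear_combination -h3
  linear_combination h4

theorem hasTrivialRadical_orth (h2 : (2 : k) ≠ 0) (hd : ∀ i, d i ≠ 0) (hn : 3 ≤ n) :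
    HasTrivialRadical k (orth (diagonal d)) := by
  refine (hasTrivialRadical_iff_no_abelian_ideals k _).2 fun I hI => ?_
  have hab : ∀ Z ∈ I, ∀ Y : orth (diagonal d), ⁅Z, ⁅Z, Y⁆⁆ = 0 := fun Z hZ Y =>
    congrArg Subtype.val (hI.trivial ⟨Z, hZ⟩ ⟨⁅Z, Y⁆, lie_mem_left k _ I _ _ hZ⟩)
  rw [eq_bot_iff]
  intro X hX
  by_contra hX0
  obtain ⟨i, j, hXij⟩ : ∃ i j, (X : Matrix (Fin n) (Fin n) k) i j ≠ 0 := by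
    by_contra! hall
    exact hX0 (Subtype.ext (Matrix.ext hall))
  have hij : i ≠ j := by
    rintro rfl
    exact hXij (orth_apply_self h2 hd X i)
  obtain ⟨l, hli, hlj⟩ := exists_ne_ne hn i j
  -- The two masks leave the entries at `(i, j)` and at `(l, b)` with `b` outside `{i, j, l}`.
  obtain ⟨Y, hY, hYX⟩ := exists_mem_ideal_mask h2 hd hX hli
  obtain ⟨Z, hZ, hZY⟩ := exists_mem_ideal_mask h2 hd hY hlj
  have hZij : (Z : Matrix (Fin n) (Fin n) k) i j ≠ 0 := by
    rw [hZY, hYX]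
    grind
  have hZlb : ∀ b, b ≠ i → b ≠ j → b ≠ l → (Z : Matrix (Fin n) (Fin n) k) b l = 0 := by
    intro b hbi hbj hbl
    have h := mul_mul_eq_of_lie_lie_rot_eq_zero h2 (hab Z hZ (rot d j b)) hij hbi.symm hlj hbl.symm
    have hjl : (Z : Matrix (Fin n) (Fin n) k) j l = 0 := by
      rw [hZY]
      grind
    rw [hjl, mul_zero] at h
    simpa [hZij, hd b] using h
  have hZlb' : ∀ b, b ≠ i → b ≠ j → b ≠ l → (Z : Matrix (Fin n) (Fin n) k) l b = 0 := by
    intro b hbi hbj hbl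
    have := mem_orth_diagonal.1 Z.2 l b
    rw [hZlb b hbi hbj hbl, zero_mul, zero_add] at this
    simpa [hd l] using this
  have hZ0 : Z = ((Z : Matrix (Fin n) (Fin n) k) i j * (d j)⁻¹) • rot d i j := by
    apply Subtype.ext
    ext p q
    have hji := mem_orth_diagonal.1 Z.2 i j
    have := hd i
    have := hd j
    rw [SetLike.val_smul, Matrix.smul_apply, rot_apply, smul_eq_mul]
    by_cases h1 : p = i ∧ q = j
    · obtain ⟨rfl, rfl⟩ := h1
      simp [hij.symm, this]
    by_cases h2 : p = j ∧ q = i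
    · obtain ⟨rfl, rfl⟩ := h2
      simp only [hij, false_and, and_self, if_false, if_true]
      field_simp
      linear_combination hji
    have h3 : (Z : Matrix (Fin n) (Fin n) k) p q = 0 := by
      have := hZY p q
      have := hYX p q
      have := hZlb p
      have := hZlb' q
      grind
    rw [h3, if_neg (by tauto), if_neg (by tauto), sub_zero, mul_zero]
  have hrot : rot d i j ∈ I := by
    have hc : (Z : Matrix (Fin n) (Fin n) k) i j * (d j)⁻¹ ≠ 0 :=
      mul_ne_zero hZij (inv_ne_zero (hd j))
    rw [hZ0] at hZ
    exact (I.toSubmodule.smul_mem_iff hc).1 hZ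
  have h := hab _ hrot (rot d j l)
  rw [rot_lie_rot hij hlj.symm hli.symm, lie_smul, rot_swap j i, neg_lie,
    rot_lie_rot hij.symm hli.symm hlj.symm] at h
  simp [hd, rot_ne_zero hd hlj.symm] at h

theorem isLieAbelian_orth (h2 : (2 : k) ≠ 0) (hd : ∀ i, d i ≠ 0) (hn : n ≤ 2) :
    IsLieAbelian (orth (diagonal d)) := by
  refine ⟨fun X Y => Subtype.ext ?_⟩
  rw [LieSubalgebra.coe_bracket, Ring.lie_def]
  have hX := orth_apply_self h2 hd X
  have hY := orth_apply_self h2 hd Y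
  have hX' := mem_orth_diagonal.1 X.2
  have hY' := mem_orth_diagonal.1 Y.2
  generalize (X : Matrix (Fin n) (Fin n) k) = A at *
  generalize (Y : Matrix (Fin n) (Fin n) k) = B at *
  change A * B - B * A = 0
  interval_cases n
  · exact Subsingleton.elim _ _
  · ext p q
    fin_cases p; fin_cases q
    simp [Matrix.mul_apply, hX, hY]
  · have h : A 0 1 * B 1 0 - B 0 1 * A 1 0 = 0 := by
      refine (mul_eq_zero.1 (?_ : d 0 * _ = 0)).resolve_left (hd 0)
      linear_combination B 1 0 * hX' 0 1 - A 1 0 * hY' 0 1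
    ext p q
    fin_cases p <;> fin_cases q <;> simp [Matrix.mul_apply, Fin.sum_univ_two, hX, hY]
    · exact h
    · linear_combination -h

end Orthogonal

/-! ### The block structure of `𝔬(0_m ⊕ D)` -/

section Blocks

open LieAlgebra Matrix

variable {k : Type*} [Field k] {m n : ℕ} {d : Fin n → k}

theorem fromBlocks_sub (A A' : gl k m) (B B' : Matrix (Fin m) (Fin n) k)
    (C C' : Matrix (Fin n) (Fin m) k) (E E' : gl k n) :
    fromBlocks A B C E - fromBlocks A' B' C' E' =
      fromBlocks (A - A') (B - B') (C - C') (E - E') := by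
  simp only [sub_eq_add_neg, fromBlocks_neg, fromBlocks_add]

theorem fromBlocks_eq_zero {A : gl k m} {B : Matrix (Fin m) (Fin n) k}
    {C : Matrix (Fin n) (Fin m) k} {E : gl k n} :
    fromBlocks A B C E = 0 ↔ A = 0 ∧ B = 0 ∧ C = 0 ∧ E = 0 := by
  rw [← fromBlocks_zero, fromBlocks_inj]

theorem fromBlocks_mem_orth (A : gl k m) (B : Matrix (Fin m) (Fin n) k) {E : gl k n}
    (hE : E ∈ orth (diagonal d)) : fromBlocks A B 0 E ∈ orth (zeroSum m (diagonal d)) := by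
  rw [mem_orth] at hE ⊢
  rw [fromBlocks_transpose, fromBlocks_multiply, fromBlocks_multiply, fromBlocks_add]
  simp [hE]

theorem exists_eq_fromBlocks (hd : ∀ i, d i ≠ 0) (X : orth (zeroSum m (diagonal d))) :
    ∃ (A : gl k m) (B : Matrix (Fin m) (Fin n) k) (E : orth (diagonal d)),
      (X : Matrix (Fin m ⊕ Fin n) (Fin m ⊕ Fin n) k) = fromBlocks A B 0 E := by
  obtain ⟨X, hX⟩ := X
  obtain ⟨A, B, C, E, rfl⟩ : ∃ A B C E, X = fromBlocks A B C E :=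
    ⟨_, _, _, _, (fromBlocks_toBlocks X).symm⟩
  rw [mem_orth, fromBlocks_transpose, fromBlocks_multiply, fromBlocks_multiply,
    fromBlocks_add] at hX
  simp only [Matrix.mul_zero, Matrix.zero_mul, zero_add] at hX
  obtain ⟨-, -, h1, h2⟩ := fromBlocks_eq_zero.1 hX
  refine ⟨A, B, ⟨E, (mem_orth _ _).2 h2⟩, ?_⟩
  have hC : C = 0 := by
    ext i j
    have := congrFun (congrFun h1 i) j
    simpa [diagonal_mul, hd i] using this
  subst hC
  rfl

/-- The projection of `𝔬(0_m ⊕ D)` to its diagonal blocks, a Lie algebra homomorphism because all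
its members are block upper triangular. -/
def blockHom (m : ℕ) (hd : ∀ i, d i ≠ 0) :
    orth (zeroSum m (diagonal d)) →ₗ⁅k⁆ gl k m × orth (diagonal d) where
  toFun X := ((X : Matrix (Fin m ⊕ Fin n) (Fin m ⊕ Fin n) k).toBlocks₁₁,
    ⟨(X : Matrix (Fin m ⊕ Fin n) (Fin m ⊕ Fin n) k).toBlocks₂₂, by
      obtain ⟨A, B, E, h⟩ := exists_eq_fromBlocks hd X
      rw [h, toBlocks_fromBlocks₂₂]
      exact E.2⟩)
  map_add' _ _ := rfl
  map_smul' _ _ := rfl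
  map_lie' := by
    intro X Y
    obtain ⟨A, B, E, hX⟩ := exists_eq_fromBlocks hd X
    obtain ⟨A', B', E', hY⟩ := exists_eq_fromBlocks hd Y
    refine Prod.ext ?_ (Subtype.ext ?_)
    · simp only [LieSubalgebra.coe_bracket, Ring.lie_def, hX, hY, fromBlocks_multiply,
        fromBlocks_sub, toBlocks_fromBlocks₁₁, Prod.bracket_apply]
      simp
    · simp only [LieSubalgebra.coe_bracket, Ring.lie_def, hX, hY, fromBlocks_multiply,
        fromBlocks_sub, toBlocks_fromBlocks₂₂, Prod.bracket_apply]
      simp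

theorem blockHom_eq {hd : ∀ i, d i ≠ 0} {X : orth (zeroSum m (diagonal d))} {A : gl k m}
    {B : Matrix (Fin m) (Fin n) k} {E : orth (diagonal d)}
    (h : (X : Matrix (Fin m ⊕ Fin n) (Fin m ⊕ Fin n) k) = fromBlocks A B 0 E) :
    blockHom m hd X = (A, E) := by
  refine Prod.ext ?_ (Subtype.ext ?_)
  · change (X : Matrix (Fin m ⊕ Fin n) (Fin m ⊕ Fin n) k).toBlocks₁₁ = A
    rw [h, toBlocks_fromBlocks₁₁]
  · change (X : Matrix (Fin m ⊕ Fin n) (Fin m ⊕ Fin n) k).toBlocks₂₂ = E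
    rw [h, toBlocks_fromBlocks₂₂]

/-- The inclusion of the block diagonal matrices in `𝔬(0_m ⊕ D)`. -/
def blockDiagHom (m : ℕ) (d : Fin n → k) :
    gl k m × orth (diagonal d) →ₗ⁅k⁆ orth (zeroSum m (diagonal d)) where
  toFun x := ⟨fromBlocks x.1 0 0 x.2, fromBlocks_mem_orth _ _ x.2.2⟩
  map_add' x y := Subtype.ext (by simp [fromBlocks_add])
  map_smul' a x := Subtype.ext (by simp [fromBlocks_smul])
  map_lie' := by
    intro x y
    apply Subtype.ext
    simp [Ring.lie_def, fromBlocks_multiply, fromBlocks_sub]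

/-- The inclusion of the upper right corner in `𝔬(0_m ⊕ D)`. -/
def corner (m : ℕ) (d : Fin n → k) :
    Matrix (Fin m) (Fin n) k →ₗ[k] orth (zeroSum m (diagonal d)) where
  toFun B := ⟨fromBlocks 0 B 0 0, fromBlocks_mem_orth _ _ (zero_mem _)⟩
  map_add' x y := Subtype.ext (by simp [fromBlocks_add])
  map_smul' a x := Subtype.ext (by simp [fromBlocks_smul])

theorem blockHom_surjective (hd : ∀ i, d i ≠ 0) : Function.Surjective (blockHom m hd) :=
  fun x => ⟨blockDiagHom m d x, blockHom_eq rfl⟩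

theorem exists_eq_add_corner (hd : ∀ i, d i ≠ 0) (X : orth (zeroSum m (diagonal d))) :
    ∃ B, X = blockDiagHom m d (blockHom m hd X) + corner m d B := by
  obtain ⟨A, B, E, hX⟩ := exists_eq_fromBlocks hd X
  refine ⟨B, Subtype.ext ?_⟩
  rw [blockHom_eq hX, hX]
  simp [blockDiagHom, corner, fromBlocks_add]

theorem lie_corner (x : gl k m × orth (diagonal d)) (B : Matrix (Fin m) (Fin n) k) :
    ⁅blockDiagHom m d x, corner m d B⁆ = corner m d (x.1 * B - B * (x.2 : gl k n)) := by
  apply Subtype.ext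
  simp [blockDiagHom, corner, Ring.lie_def, fromBlocks_multiply, fromBlocks_sub]

theorem lie_corner_corner (B B' : Matrix (Fin m) (Fin n) k) :
    ⁅corner m d B, corner m d B'⁆ = 0 := by
  apply Subtype.ext
  simp [corner, Ring.lie_def, fromBlocks_multiply]

theorem isLieAbelian_ker_blockHom (hd : ∀ i, d i ≠ 0) : IsLieAbelian (blockHom m hd).ker := by
  refine ⟨fun X Y => Subtype.ext ?_⟩
  obtain ⟨B, hX⟩ := exists_eq_add_corner hd X.1
  obtain ⟨B', hY⟩ := exists_eq_add_corner hd Y.1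
  rw [LieHom.mem_ker.1 X.2, map_zero, zero_add] at hX
  rw [LieHom.mem_ker.1 Y.2, map_zero, zero_add] at hY
  change ⁅X.1, Y.1⁆ = 0
  rw [hX, hY, lie_corner_corner]

/-- The radical of `𝔬(0_m ⊕ D)` is seen on the diagonal blocks, since the corner is an abelian
ideal. -/
theorem mem_radical_orth_zeroSum (h2 : (2 : k) ≠ 0) (hd : ∀ i, d i ≠ 0)
    (X : orth (zeroSum m (diagonal d))) :
    X ∈ radical k (orth (zeroSum m (diagonal d))) ↔
      (blockHom m hd X).1 ∈ scalars k m ∧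
        (blockHom m hd X).2 ∈ radical k (orth (diagonal d)) := by
  have := isLieAbelian_ker_blockHom (m := m) hd
  rw [radical_eq_comap (blockHom_surjective hd) inferInstance, LieIdeal.mem_comap,
    mem_radical_prod, radical_gl h2]

theorem corner_mem_derivedSeries (h2 : (2 : k) ≠ 0) (hd : ∀ i, d i ≠ 0) (hmn : 2 ≤ m ∨ 3 ≤ n)
    (r : ℕ) (B : Matrix (Fin m) (Fin n) k) :
    corner m d B ∈ derivedSeries k (orth (zeroSum m (diagonal d))) r := by
  induction r generalizing B with
  | zero => exact LieSubmodule.mem_top _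
  | succ r ih =>
    suffices h : ∀ p j c, corner m d (single p j c) ∈
        derivedSeries k (orth (zeroSum m (diagonal d))) (r + 1) by
      rw [matrix_eq_sum_single B, map_sum]
      refine sum_mem fun p _ => ?_
      rw [map_sum]
      exact sum_mem fun j _ => h _ _ _
    intro p j c
    change _ ∈ derivedSeriesOfIdeal k _ (r + 1) ⊤
    rw [derivedSeriesOfIdeal_succ]
    -- `c E_pj` is `[E_pq, c E_qj]`, or a multiple of `E_pl (rot l j)`.
    rcases hmn with hm | hn
    · have : Nontrivial (Fin m) := Fin.nontrivial_iff_two_le.2 hm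
      obtain ⟨q, hq⟩ := exists_ne p
      have hsl : (single p q 1 : gl k m) ∈ sl k m := by
        rw [mem_sl]; exact trace_single_eq_of_ne _ _ _ hq.symm
      have h1 := map_mem_derivedSeries ((blockDiagHom m d).comp
        ((LieHom.inl k _ _).comp (sl k m).incl)) (x := ⟨_, hsl⟩) (n := r)
        (by rw [derivedSeries_sl h2]; exact LieSubmodule.mem_top _)
      have h3 := LieSubmodule.lie_mem_lie h1 (ih (single q j c))
      convert h3 using 1
      change _ = ⁅blockDiagHom m d (single p q 1, 0), _⁆
      rw [lie_corner]
      simp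
    · obtain ⟨l, hl, -⟩ := exists_ne_ne hn j j
      have h1 := map_mem_derivedSeries ((blockDiagHom m d).comp (LieHom.inr k _ _))
        (x := rot d l j) (n := r)
        (by rw [derivedSeries_orth h2 hd hn]; exact LieSubmodule.mem_top _)
      have h3 := LieSubmodule.lie_mem_lie h1 (ih (single p l (-c * (d j)⁻¹)))
      convert h3 using 1
      change _ = ⁅blockDiagHom m d (0, rot d l j), _⁆
      rw [lie_corner]
      congr 1
      simp [rot, Matrix.mul_sub, single_mul_single_of_ne, hl, hd j]
      ext a b
      simp only [single_apply, Matrix.neg_apply]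
      split_ifs <;> simp

/-- The derived algebras of `𝔬(0_m ⊕ D)` contain the whole corner, on which `𝔰𝔩_m` or `𝔬(D)` acts
without coinvariants, and are otherwise determined by the diagonal blocks. -/
theorem mem_derivedSeries_orth_zeroSum (h2 : (2 : k) ≠ 0) (hd : ∀ i, d i ≠ 0)
    (hmn : 2 ≤ m ∨ 3 ≤ n) {r : ℕ} (hr : 1 ≤ r) (X : orth (zeroSum m (diagonal d))) :
    X ∈ derivedSeries k (orth (zeroSum m (diagonal d))) r ↔
      (blockHom m hd X).1 ∈ sl k m ∧
        (blockHom m hd X).2 ∈ derivedSeries k (orth (diagonal d)) r := by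
  constructor
  · intro h
    exact ⟨mem_sl.2 (trace_eq_zero_of_mem_derivedSeries hr
      (map_mem_derivedSeries ((LieHom.fst k _ _).comp (blockHom m hd)) h)),
      map_mem_derivedSeries ((LieHom.snd k _ _).comp (blockHom m hd)) h⟩
  · rintro ⟨h1, h3⟩
    obtain ⟨B, hX⟩ := exists_eq_add_corner hd X
    have h4 := map_mem_derivedSeries ((blockDiagHom m d).comp
        ((LieHom.inl k _ _).comp (sl k m).incl)) (x := ⟨_, h1⟩) (n := r)
        (by rw [derivedSeries_sl h2]; exact LieSubmodule.mem_top _)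
    have h5 := map_mem_derivedSeries ((blockDiagHom m d).comp (LieHom.inr k _ _)) h3
    rw [hX]
    refine add_mem ?_ (corner_mem_derivedSeries h2 hd hmn r B)
    convert add_mem h4 h5 using 1
    simp only [LieHom.comp_apply]
    rw [← map_add]
    congr 1
    simp

end Blocks

/-! ### Semidirect products as block triangular matrices -/

section SemidirectBlocks

open LieAlgebra Matrix

variable {k : Type*} [Field k] {m n : ℕ} {d : Fin n → k}
  {L V : Type*} [LieRing L] [LieAlgebra k L] [AddCommGroup V] [Module k V]

/-- The block triangular matrix representation of `L ⋉ V` given by representations `α`, `γ` of `L`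
and an `L`-linear map `β` from `V` to the matrices on which `L` acts through `α` and `γ`. -/
def semidirectToMatrix (τ : L →ₗ⁅k⁆ Module.End k V) (α : L →ₗ⁅k⁆ gl k m) (γ : L →ₗ⁅k⁆ gl k n)
    (β : V →ₗ[k] Matrix (Fin m) (Fin n) k)
    (hβ : ∀ x v, β (τ x v) = α x * β v - β v * γ x) :
    Semidirect τ →ₗ⁅k⁆ Matrix (Fin m ⊕ Fin n) (Fin m ⊕ Fin n) k where
  toFun z := fromBlocks (α z.right) (β z.left) 0 (γ z.right)
  map_add' z w := by
    rw [fromBlocks_add, add_zero, SemiDirectSum.add_eq_mk, ← map_add, ← map_add]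
    congr 1
    exact map_add β _ _
  map_smul' a z := by
    rw [RingHom.id_apply, fromBlocks_smul, smul_zero, SemiDirectSum.smul_eq_mk, ← map_smul,
      ← map_smul]
    congr 1
    exact map_smul β _ _
  map_lie' := by
    rintro ⟨v, x⟩ ⟨w, y⟩
    have key : ∀ v w : V, fromBlocks (α ⁅x, y⁆) (β ((0 : V) + τ x w - τ y v)) 0 (γ ⁅x, y⁆) =
        fromBlocks (α x) (β v) 0 (γ x) * fromBlocks (α y) (β w) 0 (γ y) -
          fromBlocks (α y) (β w) 0 (γ y) * fromBlocks (α x) (β v) 0 (γ x) := by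
      intro v w
      rw [LieHom.map_lie, LieHom.map_lie, zero_add, map_sub, hβ, hβ, Ring.lie_def, Ring.lie_def,
        fromBlocks_multiply, fromBlocks_multiply, fromBlocks_sub]
      simp only [Matrix.mul_zero, Matrix.zero_mul, add_zero, zero_add, sub_zero]
      congr 1
      abel
    exact key v w

/-- An ideal of `𝔬(0_m ⊕ D)` cut out by a condition on the diagonal blocks is a semidirect product:
`α` and `γ` parametrize the allowed pairs of diagonal blocks and `β` the corner. -/
theorem nonempty_ideal_equiv_semidirect (hd : ∀ i, d i ≠ 0)
    (I : LieIdeal k (orth (zeroSum m (diagonal d)))) (τ : L →ₗ⁅k⁆ Module.End k V)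
    (α : L →ₗ⁅k⁆ gl k m) (γ : L →ₗ⁅k⁆ orth (diagonal d)) (β : V ≃ₗ[k] Matrix (Fin m) (Fin n) k)
    (hβ : ∀ x v, β (τ x v) = α x * β v - β v * (γ x : gl k n))
    (hinj : ∀ x, α x = 0 → γ x = 0 → x = 0)
    (hI : ∀ X, X ∈ I ↔ ∃ x, blockHom m hd X = (α x, γ x)) : Nonempty (I ≃ₗ⁅k⁆ Semidirect τ) := by
  refine nonempty_equiv_of_range_eq ((orth (zeroSum m (diagonal d))).incl.comp I.incl)
    (semidirectToMatrix τ α ((orth (diagonal d)).incl.comp γ) β.toLinearMap hβ)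
    (fun X Y h => Subtype.ext (Subtype.ext h)) ?_ ?_
  · rw [injective_iff_map_eq_zero]
    rintro ⟨v, x⟩ h
    obtain ⟨h1, h2, -, h3⟩ := fromBlocks_eq_zero.1 h
    have hx : x = 0 := hinj x h1 (Subtype.ext h3)
    have hv : v = 0 := β.map_eq_zero_iff.1 h2
    rw [hx, hv]
    rfl
  · ext X
    simp only [LieHom.mem_range]
    constructor
    · rintro ⟨⟨Y, hY⟩, rfl⟩
      obtain ⟨x, hx⟩ := (hI Y).1 hY
      obtain ⟨A, B, E, h⟩ := exists_eq_fromBlocks hd Y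
      rw [blockHom_eq h] at hx
      obtain ⟨rfl, rfl⟩ := Prod.ext_iff.1 hx
      refine ⟨⟨β.symm B, x⟩, ?_⟩
      change fromBlocks (α x) (β (β.symm B)) 0 (γ x : gl k n) = (Y : Matrix _ _ k)
      rw [h, β.apply_symm_apply]
    · rintro ⟨⟨v, x⟩, rfl⟩
      exact ⟨⟨⟨_, fromBlocks_mem_orth (α x) (β v) (γ x).2⟩, (hI _).2 ⟨x, blockHom_eq rfl⟩⟩, rfl⟩

theorem toMatrix'_homRep {G H : Type*} [LieRing G] [LieAlgebra k G] [LieRing H] [LieAlgebra k H]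
    (σ : H →ₗ⁅k⁆ Module.End k (Fin n → k)) (ρ : G →ₗ⁅k⁆ Module.End k (Fin m → k)) (z : G × H)
    (φ : (Fin n → k) →ₗ[k] (Fin m → k)) :
    LinearMap.toMatrix' (homRep σ ρ z φ) =
      LinearMap.toMatrix' (ρ z.1) * LinearMap.toMatrix' φ -
        LinearMap.toMatrix' φ * LinearMap.toMatrix' (σ z.2) := by
  rw [← LinearMap.toMatrix'_comp, ← LinearMap.toMatrix'_comp, ← map_sub]
  rfl

theorem toMatrix'_vecRep (H : LieSubalgebra k (gl k n)) (X : H) :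
    LinearMap.toMatrix' (vecRep H X) = X :=
  LinearMap.toMatrix'_toLin' (X : gl k n)

theorem toMatrix'_scalarRep (X : gl k 1) :
    LinearMap.toMatrix' (scalarRep k 1 (Fin m) X) = X 0 0 • 1 := by
  change LinearMap.toMatrix' ((1 * X 0 0) • (LinearMap.id : (Fin m → k) →ₗ[k] _)) = _
  rw [one_mul, map_smul, LinearMap.toMatrix'_id]

/-- The homomorphism from `𝔤𝔩_1` onto the scalar matrices in `𝔤𝔩_m`. -/
def scalarHom (k : Type*) [Field k] (m : ℕ) : gl k 1 →ₗ⁅k⁆ gl k m where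
  toFun X := X 0 0 • 1
  map_add' X Y := by simp [add_smul]
  map_smul' a X := by simp [smul_smul]
  map_lie' := by
    intro X Y
    simp [Ring.lie_def, Matrix.mul_apply, mul_comm, smul_smul]

theorem scalarHom_injective (hm : 1 ≤ m) : Function.Injective (scalarHom k m) := by
  rw [injective_iff_map_eq_zero]
  intro X hX
  have := congrFun (congrFun hX ⟨0, hm⟩) ⟨0, hm⟩
  ext i j
  rw [Subsingleton.elim i 0, Subsingleton.elim j 0]
  simpa [scalarHom] using this

theorem mem_scalars_iff_exists_scalarHom {A : gl k m} :
    A ∈ scalars k m ↔ ∃ X, A = scalarHom k m X := by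
  rw [mem_scalars]
  exact ⟨fun ⟨c, h⟩ => ⟨fun _ _ => c, h.symm⟩, fun ⟨X, h⟩ => ⟨X 0 0, h.symm⟩⟩

end SemidirectBlocks

/-! ### The radical, the semisimple quotient and the derived series of `𝔬(0_m ⊕ D)` -/

section Degenerate

open LieAlgebra Matrix

variable {k : Type*} [Field k] {m n : ℕ} {d : Fin n → k}

theorem radical_orth_eq_bot (h2 : (2 : k) ≠ 0) (hd : ∀ i, d i ≠ 0) (hn : n = 1 ∨ 3 ≤ n) :
    radical k (orth (diagonal d)) = ⊥ := by
  rcases hn with rfl | hn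
  · have : Subsingleton (orth (diagonal d)) := by
      refine subsingleton_of_forall_eq 0 fun X => Subtype.ext ?_
      ext i j
      rw [Subsingleton.elim j i, orth_apply_self h2 hd]
      rfl
    exact HasTrivialRadical.radical_eq_bot
  · exact (hasTrivialRadical_orth h2 hd hn).radical_eq_bot

theorem nonempty_radical_equiv (h2 : (2 : k) ≠ 0) (hd : ∀ i, d i ≠ 0) (hm : 1 ≤ m)
    (hn : n = 1 ∨ 3 ≤ n) : Nonempty (radical k (orth (zeroSum m (diagonal d))) ≃ₗ⁅k⁆
      Semidirect (scalarRep k 1 (Fin (m * n)))) := by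
  -- `m × n` matrices as vectors of length `m * n`
  let β : (Fin (m * n) → k) ≃ₗ[k] Matrix (Fin m) (Fin n) k :=
    (LinearEquiv.funCongrLeft k k finProdFinEquiv).trans (LinearEquiv.curry k k (Fin m) (Fin n))
  refine nonempty_ideal_equiv_semidirect hd _ _ (scalarHom k m) 0 β ?_ ?_ ?_
  · intro X v
    change β ((1 * X 0 0) • v) = (X 0 0 • (1 : gl k m)) * β v - β v * 0
    rw [map_smul, one_mul, Matrix.mul_zero, sub_zero, Matrix.smul_mul, Matrix.one_mul]
  · intro X hX _
    exact scalarHom_injective hm (hX.trans (map_zero _).symm)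
  · intro X
    rw [mem_radical_orth_zeroSum h2 hd, radical_orth_eq_bot h2 hd hn, LieSubmodule.mem_bot,
      mem_scalars_iff_exists_scalarHom]
    simp [Prod.ext_iff]

theorem nonempty_radical_equiv_of_two (h2 : (2 : k) ≠ 0) (hd : ∀ i, d i ≠ 0) (hm : 1 ≤ m)
    (hn : n = 2) : Nonempty (radical k (orth (zeroSum m (diagonal d))) ≃ₗ⁅k⁆
      Semidirect (homRep (vecRep (orth (diagonal d))) (scalarRep k 1 (Fin m)))) := by
  have := isLieAbelian_orth h2 hd hn.le
  refine nonempty_ideal_equiv_semidirect hd _ _ ((scalarHom k m).comp (LieHom.fst k _ _))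
    (LieHom.snd k _ _) LinearMap.toMatrix' ?_ ?_ ?_
  · intro z φ
    rw [toMatrix'_homRep, toMatrix'_vecRep, toMatrix'_scalarRep]
    rfl
  · intro z h h'
    exact Prod.ext (scalarHom_injective hm (h.trans (map_zero _).symm)) h'
  · intro X
    rw [mem_radical_orth_zeroSum h2 hd, radical_eq_top_of_isSolvable,
      mem_scalars_iff_exists_scalarHom]
    simp [Prod.ext_iff]

/-- The homomorphisms `f` and `g` stand for any realizations of the semisimple quotients of the two
diagonal blocks. -/
theorem nonempty_ssQuot_equiv {L : Type*} [LieRing L] [LieAlgebra k L] (h2 : (2 : k) ≠ 0)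
    (hd : ∀ i, d i ≠ 0) (f : gl k m →ₗ⁅k⁆ L) (hf : Function.Surjective f)
    (hfker : ∀ A, A ∈ scalars k m ↔ f A = 0) {L' : Type*} [LieRing L'] [LieAlgebra k L']
    (g : orth (diagonal d) →ₗ⁅k⁆ L') (hg : Function.Surjective g)
    (hgker : ∀ E, E ∈ radical k (orth (diagonal d)) ↔ g E = 0) :
    Nonempty (ssQuot k (orth (zeroSum m (diagonal d))) ≃ₗ⁅k⁆ (L × L')) := by
  refine nonempty_quotient_equiv ((f.prodMap g).comp (blockHom m hd))
    ((hf.prodMap hg).comp (blockHom_surjective hd)) _ fun X => ?_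
  rw [mem_radical_orth_zeroSum h2 hd, hfker, hgker]
  exact (Prod.ext_iff (x := ((f.prodMap g).comp (blockHom m hd)) X) (y := 0)).symm

/-- The projection to the quotient by an ideal as a homomorphism of Lie algebras; Mathlib's
`LieSubmodule.Quotient.mk'` is a homomorphism of Lie modules. -/
def quotientHom {L : Type*} [LieRing L] [LieAlgebra k L] (I : LieIdeal k L) : L →ₗ⁅k⁆ L ⧸ I where
  toLinearMap := (LieSubmodule.Quotient.mk' I : L →ₗ[k] L ⧸ I)
  map_lie' := rfl

theorem quotientHom_surjective {L : Type*} [LieRing L] [LieAlgebra k L] (I : LieIdeal k L) :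
    Function.Surjective (quotientHom I) :=
  LieSubmodule.Quotient.surjective_mk' I

theorem quotientHom_eq_zero {L : Type*} [LieRing L] [LieAlgebra k L] (I : LieIdeal k L) (x : L) :
    x ∈ I ↔ quotientHom I x = 0 :=
  (LieSubmodule.Quotient.mk_eq_zero (N := I)).symm

/-- The projection of `𝔤𝔩_m` to `𝔰𝔩_m` along the scalar matrices, for `m` invertible in `k`. -/
def traceFree (hm : (m : k) ≠ 0) : gl k m →ₗ⁅k⁆ sl k m where
  toFun A := ⟨A - (A.trace / m) • 1, by
    rw [mem_sl, trace_sub, trace_smul, trace_one, Fintype.card_fin, smul_eq_mul,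
      div_mul_cancel₀ _ hm, sub_self]⟩
  map_add' A B := Subtype.ext (by simp [add_div, add_smul]; abel)
  map_smul' a A := Subtype.ext (by simp [mul_div_assoc, smul_sub, smul_smul])
  map_lie' := by
    intro A B
    apply Subtype.ext
    have h : trace ⁅A, B⁆ = 0 := matrix_trace_commutator_zero _ _ A B
    change ⁅A, B⁆ - (trace ⁅A, B⁆ / m) • 1 = ⁅A - (A.trace / m) • 1, B - (B.trace / m) • 1⁆
    rw [h, zero_div, zero_smul, sub_zero, Ring.lie_def, Ring.lie_def]
    simp only [sub_mul, mul_sub, Matrix.smul_mul, Matrix.mul_smul, Matrix.one_mul, Matrix.mul_one]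
    module

theorem traceFree_surjective (hm : (m : k) ≠ 0) : Function.Surjective (traceFree hm) := by
  rintro ⟨A, hA⟩
  refine ⟨A, Subtype.ext ?_⟩
  change A - (A.trace / m) • 1 = A
  rw [mem_sl.1 hA, zero_div, zero_smul, sub_zero]

theorem traceFree_eq_zero (hm : (m : k) ≠ 0) (A : gl k m) :
    A ∈ scalars k m ↔ traceFree hm A = 0 := by
  rw [mem_scalars, ← Subtype.coe_inj]
  change _ ↔ A - (A.trace / m) • 1 = 0
  constructor
  · rintro ⟨c, rfl⟩
    rw [trace_smul, trace_one, Fintype.card_fin, smul_eq_mul, mul_div_cancel_right₀ _ hm, sub_self]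
  · intro h
    exact ⟨_, (sub_eq_zero.1 h).symm⟩

theorem nonempty_derivedSeries_equiv (h2 : (2 : k) ≠ 0) (hd : ∀ i, d i ≠ 0)
    (hmn : 2 ≤ m ∨ 3 ≤ n) {r : ℕ} (hr : 1 ≤ r) :
    Nonempty (derivedSeries k (orth (zeroSum m (diagonal d))) r ≃ₗ⁅k⁆
      Semidirect (homRep
        ((vecRep (orth (diagonal d))).comp (derivedSeries k (orth (diagonal d)) r).incl)
        ((vecRep (sl k m)).comp (derivedSeries k (sl k m) (r - 1)).incl))) := by
  refine nonempty_ideal_equiv_semidirect hd _ _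
    ((sl k m).incl.comp ((derivedSeries k (sl k m) (r - 1)).incl.comp (LieHom.fst k _ _)))
    ((derivedSeries k (orth (diagonal d)) r).incl.comp (LieHom.snd k _ _))
    LinearMap.toMatrix' ?_ ?_ ?_
  · intro z φ
    rw [toMatrix'_homRep, LieHom.comp_apply, LieHom.comp_apply, toMatrix'_vecRep,
      toMatrix'_vecRep]
    rfl
  · intro z h h'
    exact Prod.ext (Subtype.ext (Subtype.ext h)) (Subtype.ext h')
  · intro X
    rw [mem_derivedSeries_orth_zeroSum h2 hd hmn hr]
    constructor
    · rintro ⟨h1, h3⟩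
      exact ⟨(⟨⟨_, h1⟩, by rw [derivedSeries_sl h2]; exact LieSubmodule.mem_top _⟩, ⟨_, h3⟩), rfl⟩
    · rintro ⟨z, hz⟩
      rw [hz]
      exact ⟨z.1.1.2, z.2.2⟩

theorem nonempty_derivedSeries_one_equiv (h2 : (2 : k) ≠ 0) (hd : ∀ i, d i ≠ 0)
    (hn : 3 ≤ n) :
    Nonempty (derivedSeries k (orth (zeroSum m (diagonal d))) 1 ≃ₗ⁅k⁆
      Semidirect (homRep (vecRep (orth (diagonal d))) (vecRep (sl k m)))) := by
  refine nonempty_ideal_equiv_semidirect hd _ _ ((sl k m).incl.comp (LieHom.fst k _ _))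
    (LieHom.snd k _ _) LinearMap.toMatrix' ?_ ?_ ?_
  · intro z φ
    rw [toMatrix'_homRep, toMatrix'_vecRep, toMatrix'_vecRep]
    rfl
  · intro z h h'
    exact Prod.ext (Subtype.ext h) h'
  · intro X
    rw [mem_derivedSeries_orth_zeroSum h2 hd (Or.inr hn) le_rfl, derivedSeries_orth h2 hd hn]
    constructor
    · rintro ⟨h1, -⟩
      exact ⟨(⟨_, h1⟩, _), rfl⟩
    · rintro ⟨z, hz⟩
      rw [hz]
      exact ⟨z.1.2, LieSubmodule.mem_top _⟩

theorem isSolvable_orth_zeroSum_iff (h2 : (2 : k) ≠ 0) (hd : ∀ i, d i ≠ 0) :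
    IsSolvable (orth (zeroSum m (diagonal d))) ↔ m ≤ 1 ∧ n ≤ 2 := by
  constructor
  · intro h
    have hr : ∀ X, X ∈ radical k (orth (zeroSum m (diagonal d))) := fun X => by
      rw [radical_eq_top_of_isSolvable]; exact LieSubmodule.mem_top X
    have hr' : ∀ x : gl k m × orth (diagonal d), x.1 ∈ scalars k m ∧
        x.2 ∈ radical k (orth (diagonal d)) := fun x => by
      obtain ⟨X, rfl⟩ := blockHom_surjective (m := m) hd x
      exact (mem_radical_orth_zeroSum h2 hd X).1 (hr X)
    constructor
    · by_contra! hm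
      have : Nontrivial (Fin m) := Fin.nontrivial_iff_two_le.2 hm
      obtain ⟨p, q, hpq⟩ := exists_pair_ne (Fin m)
      refine single_notMem_radical h2 hpq one_ne_zero ?_
      rw [radical_gl h2]
      exact (hr' (_, 0)).1
    · by_contra! hn
      obtain ⟨l, hl, -⟩ := exists_ne_ne hn ⟨0, by omega⟩ ⟨0, by omega⟩
      have := (hr' (0, rot d l ⟨0, by omega⟩)).2
      rw [radical_orth_eq_bot h2 hd (Or.inr hn), LieSubmodule.mem_bot] at this
      exact rot_ne_zero hd hl this
  · rintro ⟨hm, hn⟩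
    have := isLieAbelian_orth h2 hd hn
    have htop : radical k (orth (zeroSum m (diagonal d))) = ⊤ := by
      rw [eq_top_iff]
      intro X _
      rw [mem_radical_orth_zeroSum h2 hd, radical_eq_top_of_isSolvable]
      refine ⟨?_, LieSubmodule.mem_top _⟩
      rw [mem_scalars]
      have : Subsingleton (Fin m) := Fin.subsingleton_iff_le_one.2 hm
      rcases isEmpty_or_nonempty (Fin m) with h | ⟨⟨a⟩⟩
      · exact ⟨0, Subsingleton.elim _ _⟩
      · refine ⟨(blockHom m hd X).1 a a, ?_⟩
        ext i j
        rw [Subsingleton.elim i a, Subsingleton.elim j a]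
        simp
    have hs : IsSolvable (radical k (orth (zeroSum m (diagonal d)))) := inferInstance
    rw [htop] at hs
    exact (solvable_iff_equiv_solvable LieIdeal.topEquiv).1 hs

end Degenerate

end DegForm
end

theorem mainTheorem6 {k : Type*} [Field k] (hk : ringChar k ≠ 2) (m n : ℕ)
    (hm : 1 ≤ m) (hn : 1 ≤ n) (D : Matrix (Fin n) (Fin n) k)
    (hDdiag : D.IsDiag) (hDdet : IsUnit D.det) :
    -- (a) the radical
    ((n = 1 ∨ 3 ≤ n →
        Nonempty (LieAlgebra.radical k (DegForm.orth (DegForm.zeroSum m D)) ≃ₗ⁅k⁆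
          DegForm.Semidirect (DegForm.scalarRep k 1 (Fin (m * n))))) ∧
      (n = 2 →
        Nonempty (LieAlgebra.radical k (DegForm.orth (DegForm.zeroSum m D)) ≃ₗ⁅k⁆
          DegForm.Semidirect (DegForm.homRep (DegForm.vecRep (DegForm.orth D))
            (DegForm.scalarRep k 1 (Fin m)))))) ∧
    -- (b) the maximal semisimple quotient
    (Nonempty (DegForm.ssQuot k (DegForm.orth (DegForm.zeroSum m D)) ≃ₗ⁅k⁆
        (DegForm.ssQuot k (DegForm.gl k m) × DegForm.ssQuot k (DegForm.orth D))) ∧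
      (2 ≤ m → 3 ≤ n →
        (ringChar k ∣ m →
          Nonempty (DegForm.ssQuot k (DegForm.orth (DegForm.zeroSum m D)) ≃ₗ⁅k⁆
            (DegForm.pgl k m × DegForm.orth D))) ∧
        (¬ ringChar k ∣ m →
          Nonempty (DegForm.ssQuot k (DegForm.orth (DegForm.zeroSum m D)) ≃ₗ⁅k⁆
            (DegForm.sl k m × DegForm.orth D))))) ∧
    -- (c) the derived series
    ((2 ≤ m ∨ 3 ≤ n → ∀ i : ℕ, 1 ≤ i →
        Nonempty (LieAlgebra.derivedSeries k (DegForm.orth (DegForm.zeroSum m D)) i ≃ₗ⁅k⁆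
          DegForm.Semidirect (DegForm.homRep
            ((DegForm.vecRep (DegForm.orth D)).comp
              (LieAlgebra.derivedSeries k (DegForm.orth D) i).incl)
            ((DegForm.vecRep (DegForm.sl k m)).comp
              (LieAlgebra.derivedSeries k (DegForm.sl k m) (i - 1)).incl)))) ∧
      (2 ≤ m → 3 ≤ n →
        Nonempty (LieAlgebra.derivedSeries k (DegForm.orth (DegForm.zeroSum m D)) 1 ≃ₗ⁅k⁆
          DegForm.Semidirect (DegForm.homRep (DegForm.vecRep (DegForm.orth D))
            (DegForm.vecRep (DegForm.sl k m)))) ∧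
        LieAlgebra.derivedSeries k (DegForm.orth (DegForm.zeroSum m D)) 2 =
          LieAlgebra.derivedSeries k (DegForm.orth (DegForm.zeroSum m D)) 1)) ∧
    -- (d) solvability
    (LieAlgebra.IsSolvable (DegForm.orth (DegForm.zeroSum m D)) ↔ m ≤ 1 ∧ n ≤ 2) := by
  open DegForm in
  have h2 : (2 : k) ≠ 0 := Ring.two_ne_zero hk
  obtain ⟨d, rfl⟩ : ∃ d, D = Matrix.diagonal d := ⟨D.diag, hDdiag.diagonal_diag.symm⟩
  have hd : ∀ i, d i ≠ 0 := fun i => by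
    rw [Matrix.det_diagonal, isUnit_iff_ne_zero, Finset.prod_ne_zero_iff] at hDdet
    exact hDdet i (Finset.mem_univ i)
  have hid : 3 ≤ n → ∀ E, E ∈ LieAlgebra.radical k (orth (Matrix.diagonal d)) ↔
      (LieHom.id : orth (Matrix.diagonal d) →ₗ⁅k⁆ _) E = 0 := fun h E => by
    rw [radical_orth_eq_bot h2 hd (Or.inr h), LieSubmodule.mem_bot, LieHom.id_apply]
  refine ⟨⟨nonempty_radical_equiv h2 hd hm, nonempty_radical_equiv_of_two h2 hd hm⟩,
    ⟨?_, fun _ hn3 => ⟨fun _ => ?_, fun hchar => ?_⟩⟩,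
    ⟨fun hmn i hi => nonempty_derivedSeries_equiv h2 hd hmn hi, fun hm2 hn3 =>
      ⟨nonempty_derivedSeries_one_equiv h2 hd hn3, ?_⟩⟩, isSolvable_orth_zeroSum_iff h2 hd⟩
  · refine nonempty_ssQuot_equiv h2 hd (quotientHom _) (quotientHom_surjective _) (fun A => ?_)
      (quotientHom _) (quotientHom_surjective _) (quotientHom_eq_zero _)
    rw [← quotientHom_eq_zero, radical_gl h2]
  · exact nonempty_ssQuot_equiv h2 hd (quotientHom _) (quotientHom_surjective _)
      (quotientHom_eq_zero _) LieHom.id Function.surjective_id (hid hn3)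
  · have hm0 : (m : k) ≠ 0 := fun h => hchar ((ringChar.spec k m).1 h)
    exact nonempty_ssQuot_equiv h2 hd (traceFree hm0) (traceFree_surjective hm0)
      (traceFree_eq_zero hm0) LieHom.id Function.surjective_id (hid hn3)
  · ext X
    rw [mem_derivedSeries_orth_zeroSum h2 hd (Or.inr hn3) one_le_two,
      mem_derivedSeries_orth_zeroSum h2 hd (Or.inr hn3) le_rfl, derivedSeries_orth h2 hd hn3,
      derivedSeries_orth h2 hd hn3]
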